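/- Theorem (Linear LRC codes with disjoint repair groups). Let $r\ge 0$ be an integer. A code $C\subset Q^n$ has locality $r$ with disjoint repair groups if every coordinate $i\in[n]$ lies in a set $\mathcal R_i\subset[n]$ with $|\mathcal R_i|\le r+1$, such that for some function $\phi_i$ the equality $c_i=\phi_i\big((c_j)_{j\in\mathcal R_i\setminus\{i\}}\big)$ holds for all $c\in C$, and any two distinct sets among $\mathcal R_1,\dots,\mathcal R_n$ are disjoint. Let $M(n,r,d)$ be the largest cardinality of a binary linear code of length $n$, with minimum distance at least $d$, that has locality $r$ with disjoint repair groups, and put $$R^{(\mathrm{lin,dis})}(r,\delta)=\limsup_{n\to\infty}\frac1n\log_2 M(n,r,\delta n).$$ Let $0\le\delta<1/2$, $\tau=\frac12-\sqrt{\delta(1-\delta)}$ and $t=\lfloor (r+1)/2\rfloor$. Put $$b_i=\binom{r+1}i\ \ (0\le i<t),\qquad b_t=\binom{r+1}t\Big/2^{\,r\bmod 2},\qquad \beta_i(x)=\frac{b_i}{x^i}\ \ (0\le i\le t).$$ Then $$R^{(\mathrm{lin,dis})}(r,\delta)\le \tau\log_2\mu+\frac{\log_2\big(\sum_{i=0}^t\beta_i(\mu)\big)}{r+1},$$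 where $\mu$ is as follows. (1) If $\sum_{i=0}^t i\,\dfrac{\beta_i(1)}{\sum_{\ell=0}^t\beta_\ell(1)}\le (r+1)\tau$, then the bound holds with $\mu=1$. (2) Otherwise, each of the two polynomials $$(r+1)\tau\sum_{i=0}^t\binom{r+1}i x^{t-i}-\sum_{i=0}^t i\binom{r+1}i x^{t-i},\qquad (r+1)\tau\sum_{i=0}^t b_i x^{t-i}-\sum_{i=0}^t i\,b_i x^{t-i}$$ has a unique positive zero, and the bound holds with $\mu$ equal to the positive zero of either polynomial. (The polynomials coincide when $r$ is even.) -/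

import Mathlib

open scoped Polynomial

noncomputable section

namespace LRC

/-- `R` is a repair group for the coordinate `i` of the code `C`: it contains `i`, and a single
function of the remaining coordinates in `R` computes the `i`-th coordinate of every codeword. -/
def IsRepairGroup {Q : Type*} {n : ℕ} (C : Set (Fin n → Q)) (i : Fin n) (R : Finset (Fin n)) :
    Prop :=
  i ∈ R ∧ ∃ φ : (↥(R.erase i) → Q) → Q, ∀ c ∈ C, c i = φ (fun j => c j)

/-- `C` has locality `r` with disjoint repair groups: one can choose for every coordinate `i` a
repair group `R i` of size at most `r + 1` so that any two distinct chosen groups are disjoint.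
As `i ∈ R i`, the chosen groups partition the set of coordinates. -/
def HasDisjointRepairGroups {Q : Type*} {n : ℕ} (C : Set (Fin n → Q)) (r : ℕ) : Prop :=
  ∃ R : Fin n → Finset (Fin n),
    (∀ i, IsRepairGroup C i (R i) ∧ (R i).card ≤ r + 1) ∧
    ∀ i j, R i ≠ R j → Disjoint (R i) (R j)

/-- The pairwise Hamming distances of distinct codewords are at least the real number `d`. -/
def MinDistGE {Q : Type*} [DecidableEq Q] {n : ℕ} (C : Set (Fin n → Q)) (d : ℝ) : Prop :=
  ∀ x ∈ C, ∀ y ∈ C, x ≠ y → d ≤ (hammingDist x y : ℝ)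

/-- Largest cardinality of a binary linear code of length `n` and distance at least `d` that has
locality `r` with disjoint repair groups. -/
def maxCard (n r : ℕ) (d : ℝ) : ℕ :=
  sSup {M : ℕ | ∃ C : Submodule (ZMod 2) (Fin n → ZMod 2),
    HasDisjointRepairGroups (C : Set (Fin n → ZMod 2)) r ∧
    MinDistGE (C : Set (Fin n → ZMod 2)) d ∧ Nat.card C = M}

/-- Largest asymptotic rate of binary linear codes of relative distance `δ` that have locality `r`
with disjoint repair groups. -/
def asympRate (r : ℕ) (δ : ℝ) : ℝ :=
  Filter.limsup (fun n : ℕ => Real.logb 2 (maxCard n r (δ * n)) / n) Filter.atTop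

/-- `τ = 1/2 - √(δ(1-δ))`. -/
def tau (δ : ℝ) : ℝ := 1 / 2 - Real.sqrt (δ * (1 - δ))

/-- `t = ⌊(r+1)/2⌋`. -/
def tt (r : ℕ) : ℕ := (r + 1) / 2

/-- The constants `b_i`: the binomial coefficient for `i < t`, and the binomial coefficient divided
by `2 ^ (r mod 2)` for `i = t`. -/
def bcoef (r i : ℕ) : ℝ :=
  if i < tt r then ((r + 1).choose i : ℝ) else ((r + 1).choose i : ℝ) / 2 ^ (r % 2)

/-- `β_i(x) = b_i / x^i`. -/
def beta (r i : ℕ) (x : ℝ) : ℝ := bcoef r i / x ^ i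

/-- The mean `∑ i β_i(x) / ∑ β_l(x)`. -/
def betaMean (r : ℕ) (x : ℝ) : ℝ :=
  ∑ i ∈ Finset.range (tt r + 1), (i : ℝ) * (beta r i x / ∑ l ∈ Finset.range (tt r + 1), beta r l x)

/-- The right-hand side `τ log x + log (∑ β_i(x)) / (r+1)` of the rate bound, with `log` to base
`2`. -/
def rateBound (r : ℕ) (δ x : ℝ) : ℝ :=
  tau δ * Real.logb 2 x
    + Real.logb 2 (∑ i ∈ Finset.range (tt r + 1), beta r i x) / ((r : ℝ) + 1)

/-- The polynomial `(r+1) τ ∑ w_i x^(t-i) - ∑ w_i i x^(t-i)` for given weights `w`. -/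
def rootPoly (r : ℕ) (δ : ℝ) (w : ℕ → ℝ) : ℝ[X] :=
  Polynomial.C (((r : ℝ) + 1) * tau δ) *
      ∑ i ∈ Finset.range (tt r + 1), Polynomial.C (w i) * Polynomial.X ^ (tt r - i)
    - ∑ i ∈ Finset.range (tt r + 1), Polynomial.C (w i * i) * Polynomial.X ^ (tt r - i)

/-- `μ` is the unique positive zero of `p`. -/
def IsUniquePosRoot (p : ℝ[X]) (μ : ℝ) : Prop :=
  (0 < μ ∧ p.eval μ = 0) ∧ ∀ y : ℝ, 0 < y → p.eval y = 0 → y = μ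

end LRC

end

/-!
The proof is a covering argument on the Hamming cube in the manner of Friedman and Tillich. Let
`C` be a linear code of distance `d`, and let `A` be the adjacency operator of the cube. The
Hamming ball of radius `ρ n` carries a nonnegative function `f` with `A f ≥ lam f`, where `lam` is
about `2 √(ρ (1 - ρ)) n` (`exists_ball_function`). As soon as `lam ≥ n - 2 d + 1`, which for `d =
δ n` means `ρ > τ`, comparison with the eigenvalues `n - 2|c|`, `c ∈ C`, shows that the frequency
`0` carries at least the fraction `1 / (2 d)` of the energy of `f` on `C` (`sum_sq_fhat_le`). By
Cauchy–Schwarz the translates of the ball by any code `D` orthogonal to `C` then cover at least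
`|C| |D| / (2 d)` points (`card_mul_card_le`).

The locality enters through the choice of `D`. Each repair group supports a nonzero word of the
dual code (`exists_dual_word_of_isRepairGroup`), and `D` is the span of one such word for each of
the `m` groups. Up to a factor `|D|`, the number of points covered is the number of cosets of `D`
that meet the ball, and this is at most `x ^ (ρ n)` times the weight enumerator of the coset
leaders of `D` at `y = 1 / x`, for every `x ≥ 1`. The enumerator is a product over the groups.
Write `2 W_s(y)` for `foldedPoly y s`. A group of size `k` whose dual word has weight `s`
contributes `W_s(y) (1 + y) ^ (k - s)`, and `u_s = W_s(y) / (1 + y) ^ s` is at most `1` and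
increases with `s`. As `s ≤ r + 1` and `m ≥ n / (r + 1)`, the product is at most `W_{r+1}(y) ^ (n
/ (r + 1))`, and `W_{r+1}(1 / x) = ∑ β_i(x)` (`foldedPoly_succ_eq`). Taking logarithms and letting
`ρ` tend to `τ` gives the rate bound for every `x ≥ 1` if `0 < δ < 1 / 2`; for `x = 1` it follows
for all `δ` from `|C| |D| ≤ 2 ^ n`.

Both polynomials of the second case are negative at `1` and have a unique positive zero
(`exists_isUniquePosRoot`), so this zero exceeds `1` and the rate bound applies to it.
-/

noncomputable section

namespace LRC

variable {n : ℕ}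

/-! ### Characters and the covering inequality -/

instance submoduleFintype (C : Submodule (ZMod 2) (Fin n → ZMod 2)) : Fintype C :=
  Fintype.ofFinite C

/-- The nontrivial character `ZMod 2 → {1, -1}`, with real values. -/
def sgn (a : ZMod 2) : ℝ := if a = 0 then 1 else -1

lemma sgn_add (a b : ZMod 2) : sgn (a + b) = sgn a * sgn b := by
  have h : ∀ a : ZMod 2, a = 0 ∨ a = 1 := by decide
  have h10 : (1 : ZMod 2) ≠ 0 := by decide
  have h11 : (1 : ZMod 2) + 1 = 0 := by decide
  rcases h a with rfl | rfl <;> rcases h b with rfl | rfl <;> simp [sgn, h10, h11]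

/-- The character `x ↦ (-1) ^ ⟨c, x⟩` of the cube `(ZMod 2)ⁿ`. -/
def chi (c x : Fin n → ZMod 2) : ℝ := sgn (c ⬝ᵥ x)

lemma chi_add_right (c x y : Fin n → ZMod 2) : chi c (x + y) = chi c x * chi c y := by
  simp [chi, dotProduct_add, sgn_add]

lemma chi_add_left (b c x : Fin n → ZMod 2) : chi (b + c) x = chi b x * chi c x := by
  simp [chi, add_dotProduct, sgn_add]

/-- The Fourier coefficient of `f` at `c`, without normalization. -/
def fhat (f : (Fin n → ZMod 2) → ℝ) (c : Fin n → ZMod 2) : ℝ := ∑ x, f x * chi c x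

lemma fhat_zero (f : (Fin n → ZMod 2) → ℝ) : fhat f 0 = ∑ x, f x := by
  simp [fhat, chi, sgn]

/-- The sum of the characters indexed by `C`: it is `|C|` on the dual code and `0` elsewhere. -/
def charSum (C : Submodule (ZMod 2) (Fin n → ZMod 2)) (v : Fin n → ZMod 2) : ℝ :=
  ∑ c : C, chi (c : Fin n → ZMod 2) v

lemma charSum_of_orthogonal (C : Submodule (ZMod 2) (Fin n → ZMod 2)) {v : Fin n → ZMod 2}
    (h : ∀ c ∈ C, c ⬝ᵥ v = 0) : charSum C v = Nat.card C := by
  have : ∀ c : C, chi (c : Fin n → ZMod 2) v = 1 := fun c => by simp [chi, h c c.2, sgn]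
  simp [charSum, this, Nat.card_eq_fintype_card]

lemma charSum_nonneg (C : Submodule (ZMod 2) (Fin n → ZMod 2)) (v : Fin n → ZMod 2) :
    0 ≤ charSum C v := by
  by_cases h : ∀ c ∈ C, c ⬝ᵥ v = 0
  · rw [charSum_of_orthogonal C h]; positivity
  · push Not at h
    obtain ⟨b, hb, hbv⟩ := h
    -- translating the sum by `b` changes its sign
    have key : charSum C v = -charSum C v := by
      refine (Equiv.sum_comp (Equiv.addRight (⟨b, hb⟩ : C)) fun c : C => chi (c : Fin n → ZMod 2) v
        ).symm.trans ?_
      rw [charSum, ← Finset.sum_neg_distrib]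
      refine Finset.sum_congr rfl fun c _ => ?_
      have hb1 : chi b v = -1 := by simp [chi, sgn, hbv]
      simp only [Equiv.coe_addRight, Submodule.coe_add, chi_add_left, hb1]
      ring
    linarith

lemma sum_fhat_mul_fhat (C : Submodule (ZMod 2) (Fin n → ZMod 2))
    (f g : (Fin n → ZMod 2) → ℝ) :
    ∑ c : C, fhat g (c : Fin n → ZMod 2) * fhat f c =
      ∑ x, g x * ∑ y, f y * charSum C (x + y) := by
  have : ∀ c : C, fhat g (c : Fin n → ZMod 2) * fhat f c =
      ∑ x, ∑ y, g x * (f y * chi (c : Fin n → ZMod 2) (x + y)) := by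
    intro c
    rw [fhat, fhat, Finset.sum_mul_sum]
    refine Finset.sum_congr rfl fun x _ => Finset.sum_congr rfl fun y _ => ?_
    rw [chi_add_right]; ring
  simp_rw [this, charSum, Finset.mul_sum]
  rw [Finset.sum_comm]
  refine Finset.sum_congr rfl fun x _ => ?_
  rw [Finset.sum_comm]

lemma add_self_eq_zero_vec (x : Fin n → ZMod 2) : x + x = 0 := by
  funext i; exact CharTwo.add_self_eq_zero (x i)

/-- The adjacency operator of the Hamming cube: the sum of `f` over the `n` neighbours of `x`. -/
def adj (f : (Fin n → ZMod 2) → ℝ) (x : Fin n → ZMod 2) : ℝ :=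
  ∑ i, f (x + Pi.single i 1)

/-- Characters are eigenfunctions of the cube: that of `c` has eigenvalue `n - 2|c|`. -/
lemma fhat_adj (f : (Fin n → ZMod 2) → ℝ) (c : Fin n → ZMod 2) :
    fhat (adj f) c = (n - 2 * hammingNorm c) * fhat f c := by
  have h1 : ∀ i, ∑ x, f (x + Pi.single i 1) * chi c x = sgn (c i) * fhat f c := by
    intro i
    rw [← Equiv.sum_comp (Equiv.addRight (Pi.single i (1 : ZMod 2))), fhat, Finset.mul_sum]
    refine Finset.sum_congr rfl fun x _ => ?_
    simp only [Equiv.coe_addRight, add_assoc, add_self_eq_zero_vec, add_zero, chi_add_right]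
    simp [chi]; ring
  have h2 : ∑ i, sgn (c i) = (n : ℝ) - 2 * hammingNorm c := by
    have : ∀ i, sgn (c i) = 1 - 2 * (if c i ≠ 0 then 1 else 0) := by
      intro i; by_cases h : c i = 0 <;> simp [sgn, h]; norm_num
    simp_rw [this, Finset.sum_sub_distrib, ← Finset.mul_sum]
    rw [Finset.sum_boole]; simp [hammingNorm]
  simp only [fhat, adj, Finset.sum_mul]
  rw [Finset.sum_comm]
  simp_rw [h1]
  rw [← Finset.sum_mul, h2, fhat]

/-- If `f ≥ 0` satisfies `A f ≥ lam f` for the adjacency operator `A`, then `∑ (n - 2|c|) fhat(c)²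
≥ lam ∑ fhat(c)²` over `c ∈ C`, whereas all `c ≠ 0` in a code of distance `d` have `n - 2|c| ≤ n -
2d`. For `lam > n - 2d` the zero frequency therefore carries a definite share of the energy. -/
lemma sum_sq_fhat_le (C : Submodule (ZMod 2) (Fin n → ZMod 2)) {f : (Fin n → ZMod 2) → ℝ}
    (hf : ∀ x, 0 ≤ f x) {lam d : ℝ} (hlam : ∀ x, lam * f x ≤ adj f x)
    (hd : ∀ c ∈ C, c ≠ 0 → d ≤ (hammingNorm c : ℝ)) :
    (lam - (n - 2 * d)) * ∑ c : C, fhat f c ^ 2 ≤ 2 * d * fhat f 0 ^ 2 := by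
  have h1 : lam * ∑ c : C, fhat f c ^ 2 ≤ ∑ c : C, fhat (adj f) c * fhat f c := by
    have : ∑ c : C, fhat f c ^ 2 = ∑ c : C, fhat f c * fhat f c := by simp_rw [sq]
    rw [this, sum_fhat_mul_fhat, sum_fhat_mul_fhat, Finset.mul_sum]
    refine Finset.sum_le_sum fun x _ => ?_
    rw [← mul_assoc]
    exact mul_le_mul_of_nonneg_right (hlam x)
      (Finset.sum_nonneg fun y _ => mul_nonneg (hf y) (charSum_nonneg C _))
  have h2 : ∑ c : C, fhat (adj f) c * fhat f c ≤
      ∑ c : C, ((n - 2 * d) * fhat f c ^ 2 + if c = 0 then 2 * d * fhat f 0 ^ 2 else 0) := by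
    refine Finset.sum_le_sum fun c _ => ?_
    rw [fhat_adj]
    by_cases h : c = 0
    · subst h; simp; nlinarith
    · have := hd c c.2 (by simpa using h)
      simp only [h, if_false]
      nlinarith [sq_nonneg (fhat f (c : Fin n → ZMod 2))]
  rw [Finset.sum_add_distrib, ← Finset.mul_sum] at h2
  simp only [Finset.sum_ite_eq', Finset.mem_univ, if_true] at h2
  nlinarith

/-- The covering inequality. If the zero frequency carries at least the fraction `1 / K` of the
energy of `f` on `C`, then the translates of the support of `f` by a code `D` orthogonal to `C`
fill at least `|C| |D| / K` points: by Cauchy–Schwarz, the sum of these translates of `f` cannot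
have small support. -/
theorem card_mul_card_le (C D : Submodule (ZMod 2) (Fin n → ZMod 2))
    (hCD : ∀ c ∈ C, ∀ z ∈ D, c ⬝ᵥ z = 0) {f : (Fin n → ZMod 2) → ℝ}
    (hf : ∀ x, 0 ≤ f x) (hpos : 0 < ∑ x, f x) {S : Finset (Fin n → ZMod 2)}
    (hS : ∀ x, f x ≠ 0 → ∀ z ∈ D, x + z ∈ S) {K : ℝ}
    (hK : ∑ c : C, fhat f c ^ 2 ≤ K * fhat f 0 ^ 2) :
    (Nat.card C : ℝ) * Nat.card D ≤ K * S.card := by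
  -- the sum of the translates of `f` by `D`
  set F : (Fin n → ZMod 2) → ℝ := fun x => ∑ z : D, f (x + z) with hF
  have hsupp : ∀ x, x ∉ S → F x = 0 := by
    intro x hx
    refine Finset.sum_eq_zero fun z _ => ?_
    by_contra h
    have := hS _ h z z.2
    rw [add_assoc, add_self_eq_zero_vec, add_zero] at this
    exact hx this
  have hinv : ∀ x, ∀ z : D, F (x + z) = F x := by
    intro x z
    simp only [hF]
    rw [← Equiv.sum_comp (Equiv.addLeft z)]
    refine Finset.sum_congr rfl fun w _ => ?_
    simp only [Equiv.coe_addLeft, Submodule.coe_add]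
    rw [← add_assoc, add_assoc x, add_self_eq_zero_vec, add_zero]
  have hsum : ∑ x, F x = Nat.card D * ∑ x, f x := by
    simp only [hF]
    rw [Finset.sum_comm]
    have : ∀ z : D, ∑ x, f (x + z) = ∑ x, f x := fun z =>
      Equiv.sum_comp (Equiv.addRight (z : Fin n → ZMod 2)) f
    simp [this, Nat.card_eq_fintype_card]
  have hsq : ∑ x, F x ^ 2 = Nat.card D * ∑ x, f x * F x := by
    have : ∀ x, F x ^ 2 = ∑ z : D, f (x + z) * F (x + z) := by
      intro x
      simp_rw [hinv, ← Finset.sum_mul, sq]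
      rfl
    simp_rw [this]
    rw [Finset.sum_comm]
    have : ∀ z : D, ∑ x, f (x + z) * F (x + z) = ∑ x, f x * F x := fun z =>
      Equiv.sum_comp (Equiv.addRight (z : Fin n → ZMod 2)) (fun x => f x * F x)
    simp [this, Nat.card_eq_fintype_card]
  have hcs : (∑ x, F x) ^ 2 ≤ S.card * ∑ x, F x ^ 2 := by
    have e1 : ∑ x, F x = ∑ x ∈ S, F x :=
      (Finset.sum_subset (Finset.subset_univ S) fun x _ hx => hsupp x hx).symm
    rw [e1]
    refine sq_sum_le_card_mul_sum_sq.trans ?_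
    gcongr
    exact Finset.subset_univ S
  have hlow : (Nat.card C : ℝ) * ∑ x, f x * F x ≤ ∑ c : C, fhat f c ^ 2 := by
    have e : ∑ c : C, fhat f c ^ 2 = ∑ c : C, fhat f c * fhat f c := by simp_rw [sq]
    rw [e, sum_fhat_mul_fhat, Finset.mul_sum]
    refine Finset.sum_le_sum fun x _ => ?_
    rw [mul_left_comm]
    refine mul_le_mul_of_nonneg_left ?_ (hf x)
    -- all terms are nonnegative; only those with `y ∈ x + D` are kept
    have himg : ∑ z : D, f (x + z) * charSum C (x + (x + z)) ≤
        ∑ y, f y * charSum C (x + y) := by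
      rw [← Finset.sum_image (f := fun y => f y * charSum C (x + y))
        (g := fun z : D => x + (z : Fin n → ZMod 2))]
      · exact Finset.sum_le_sum_of_subset_of_nonneg (Finset.subset_univ _)
          fun y _ _ => mul_nonneg (hf y) (charSum_nonneg C _)
      · intro a _ b _ hab
        exact Subtype.ext (add_left_cancel hab)
    refine le_trans (le_of_eq ?_) himg
    simp only [hF, Finset.mul_sum]
    refine Finset.sum_congr rfl fun z _ => ?_
    rw [← add_assoc, add_self_eq_zero_vec, zero_add,
      charSum_of_orthogonal C fun c hc => hCD c hc z z.2]
    ring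
  rw [fhat_zero] at hK
  rw [hsum, hsq] at hcs
  have hDpos : (0 : ℝ) < Nat.card D := by exact_mod_cast Nat.card_pos
  have hCpos : (0 : ℝ) < Nat.card C := by exact_mod_cast Nat.card_pos
  set s := ∑ x, f x
  set N := ∑ x, f x * F x
  have h3 : (Nat.card D : ℝ) * s ^ 2 ≤ S.card * N := by
    have : (Nat.card D : ℝ) * (Nat.card D * s ^ 2) ≤ Nat.card D * (S.card * N) := by
      calc _ = (Nat.card D * s) ^ 2 := by ring
        _ ≤ _ := hcs
        _ = _ := by ring
    exact le_of_mul_le_mul_left this hDpos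
  have h4 : (Nat.card C : ℝ) * Nat.card D * s ^ 2 ≤ K * S.card * s ^ 2 := by
    calc (Nat.card C : ℝ) * Nat.card D * s ^ 2 = Nat.card C * (Nat.card D * s ^ 2) := by ring
      _ ≤ Nat.card C * (S.card * N) := by gcongr
      _ = S.card * (Nat.card C * N) := by ring
      _ ≤ S.card * (K * s ^ 2) :=
        mul_le_mul_of_nonneg_left (hlow.trans hK) (by positivity)
      _ = _ := by ring
  exact le_of_mul_le_mul_right h4 (by positivity)

/-- Mutually orthogonal codes satisfy `|C| |D| ≤ 2 ^ n`: the covering inequality for a constant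
function. -/
theorem card_mul_card_le_two_pow (C D : Submodule (ZMod 2) (Fin n → ZMod 2))
    (hCD : ∀ c ∈ C, ∀ z ∈ D, c ⬝ᵥ z = 0) :
    (Nat.card C : ℝ) * Nat.card D ≤ 2 ^ n := by
  have hadj : ∀ x : Fin n → ZMod 2, adj (fun _ => 1) x = n * 1 := by simp [adj]
  have hz : ∀ c : Fin n → ZMod 2, c ≠ 0 → fhat (fun _ => 1) c = 0 := by
    intro c hc
    have h1 := fhat_adj (fun _ => (1 : ℝ)) c
    have h2 : fhat (adj fun _ : Fin n → ZMod 2 => (1 : ℝ)) c = n * fhat (fun _ => 1) c := by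
      simp only [fhat, hadj, Finset.mul_sum, mul_assoc]
    have h3 : (hammingNorm c : ℝ) ≠ 0 := by
      exact_mod_cast (hammingNorm_ne_zero_iff.2 hc)
    have h4 : (hammingNorm c : ℝ) * fhat (fun _ => 1) c = 0 := by linarith
    exact (mul_eq_zero.1 h4).resolve_left h3
  have := card_mul_card_le C D hCD (f := fun _ => 1) (fun _ => zero_le_one) (by simp)
    (S := Finset.univ) (by simp) (K := 1) (by
      rw [one_mul, Finset.sum_eq_single (0 : C)]
      · rfl
      · intro c _ hc
        rw [hz _ (by simpa using hc)]; simp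
      · simp)
  simpa [ZMod.card] using this

/-! ### Approximate eigenfunctions of Hamming balls -/

lemma hammingNorm_add_single_of_eq_zero {x : Fin n → ZMod 2} {i : Fin n} (h : x i = 0) :
    hammingNorm (x + Pi.single i 1) = hammingNorm x + 1 := by
  unfold hammingNorm
  rw [← Finset.card_insert_of_notMem (a := i) (by simp [h])]
  congr 1
  ext j
  by_cases hj : j = i
  · subst hj; simp [h]
  · simp [hj]

lemma hammingNorm_add_single_of_ne_zero {x : Fin n → ZMod 2} {i : Fin n} (h : x i ≠ 0) :
    hammingNorm (x + Pi.single i 1) + 1 = hammingNorm x := by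
  have h1 : x i = 1 := by revert h; generalize x i = a; revert a; decide
  have h2 : (x + Pi.single i 1 : Fin n → ZMod 2) i = 0 := by
    simp [h1]; decide
  have := hammingNorm_add_single_of_eq_zero h2
  rw [add_assoc, add_self_eq_zero_vec, add_zero] at this
  exact this.symm

/-- The truncated `hammingNorm x - 1` is harmless: for `x = 0` its coefficient vanishes. -/
lemma adj_radial (g : ℕ → ℝ) (x : Fin n → ZMod 2) :
    adj (fun v => g (hammingNorm v)) x =
      hammingNorm x * g (hammingNorm x - 1) + (n - hammingNorm x) * g (hammingNorm x + 1) := by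
  have : ∀ i, g (hammingNorm (x + Pi.single i 1)) =
      (if x i ≠ 0 then g (hammingNorm x - 1) - g (hammingNorm x + 1) else 0)
        + g (hammingNorm x + 1) := by
    intro i
    by_cases h : x i = 0
    · simp [h, hammingNorm_add_single_of_eq_zero h]
    · simp [h, ← hammingNorm_add_single_of_ne_zero h]
  simp only [adj, this]
  rw [Finset.sum_add_distrib, ← Finset.sum_filter, Finset.sum_const, Finset.sum_const]
  simp only [hammingNorm, nsmul_eq_mul, Finset.card_univ, Fintype.card_fin]
  ring

lemma exists_hammingNorm_eq {k : ℕ} (hk : k ≤ n) : ∃ x : Fin n → ZMod 2, hammingNorm x = k := by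
  obtain ⟨s, -, hs⟩ := Finset.exists_subset_card_eq (s := (Finset.univ : Finset (Fin n)))
    (n := k) (by simpa using hk)
  refine ⟨fun i => if i ∈ s then 1 else 0, ?_⟩
  rw [← hs, hammingNorm]
  congr 1; ext i; simp

/-- A nonnegative function on the Hamming ball of radius `a + L` with `A f ≥ lam f` pointwise,
where `lam = 2 cos (π / L) √(a (n - a - L))` is close to the largest eigenvalue of the ball. It is
radial, `θ ^ k sin (π (k - a) / L)` at weight `k ∈ [a, a + L]`. There, a point has at least `a`
neighbours of weight `k - 1` and at least `n - a - L` neighbours of weight `k + 1`; the choice of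
`θ` makes the two resulting coefficients equal, so that the addition formula for the sine applies.
-/
theorem exists_ball_function {a L : ℕ} (ha : 1 ≤ a) (hL : 2 ≤ L) (haL : a + L < n) :
    ∃ f : (Fin n → ZMod 2) → ℝ, (∀ x, 0 ≤ f x) ∧ (0 < ∑ x, f x) ∧
      (∀ x, f x ≠ 0 → hammingNorm x ≤ a + L) ∧
      ∀ x, 2 * Real.cos (Real.pi / L) * Real.sqrt (a * (n - a - L)) * f x ≤ adj f x := by
  have haR : (0 : ℝ) < a := by exact_mod_cast ha
  have hbR : (0 : ℝ) < (n : ℝ) - a - L := by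
    have : ((a + L : ℕ) : ℝ) < n := by exact_mod_cast haL
    push_cast at this; linarith
  have hLR : (2 : ℝ) ≤ L := by exact_mod_cast hL
  set b : ℝ := (n : ℝ) - a - L with hb
  set θ : ℝ := Real.sqrt a / Real.sqrt b with hθ
  have hsa : 0 < Real.sqrt a := Real.sqrt_pos.2 haR
  have hsb : 0 < Real.sqrt b := Real.sqrt_pos.2 hbR
  have hθ0 : 0 < θ := div_pos hsa hsb
  set κ : ℝ := Real.sqrt (a * b) with hκ
  have hκ1 : κ * θ = a := by
    rw [hκ, hθ, Real.sqrt_mul haR.le]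
    field_simp
    exact Real.sq_sqrt haR.le
  have hκ2 : κ = b * θ := by
    rw [hκ, hθ, Real.sqrt_mul haR.le]
    field_simp
    rw [Real.sq_sqrt hbR.le]
  set s : ℕ → ℝ := fun k => Real.sin (((k : ℝ) - a) * (Real.pi / L)) with hs
  set g : ℕ → ℝ := fun k => if a ≤ k ∧ k ≤ a + L then θ ^ k * s k else 0 with hg
  have hs0 : ∀ k, a ≤ k → k ≤ a + L → 0 ≤ s k := by
    intro k h1 h2
    have h1' : (a : ℝ) ≤ k := by exact_mod_cast h1
    have h2' : (k : ℝ) ≤ a + L := by exact_mod_cast h2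
    apply Real.sin_nonneg_of_nonneg_of_le_pi
    · exact mul_nonneg (by linarith) (by positivity)
    · calc ((k : ℝ) - a) * (Real.pi / L) ≤ L * (Real.pi / L) := by
            gcongr; linarith
        _ = Real.pi := by field_simp
  have hg0 : ∀ k, 0 ≤ g k := by
    intro k
    simp only [hg]
    split_ifs with h
    · exact mul_nonneg (by positivity) (hs0 k h.1 h.2)
    · exact le_rfl
  refine ⟨fun x => g (hammingNorm x), fun x => hg0 _, ?_, ?_, ?_⟩
  · obtain ⟨x, hx⟩ := exists_hammingNorm_eq (n := n) (k := a + 1) (by omega)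
    refine Finset.sum_pos' (fun x _ => hg0 _) ⟨x, Finset.mem_univ _, ?_⟩
    simp only [hx, hg]
    rw [if_pos ⟨by omega, by omega⟩]
    refine mul_pos (by positivity) (Real.sin_pos_of_pos_of_lt_pi ?_ ?_)
    · push_cast; simp; positivity
    · push_cast
      rw [add_sub_cancel_left, one_mul, div_lt_iff₀ (by linarith)]
      nlinarith [Real.pi_pos]
  · intro x hx
    by_contra h
    exact hx (by simp only [hg]; rw [if_neg (by omega)])
  · intro x
    rw [adj_radial]
    change _ * g (hammingNorm x) ≤ _
    have hkn : (hammingNorm x : ℝ) ≤ n := by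
      exact_mod_cast (hammingNorm_le_card_fintype (x := x)).trans (by simp)
    set k := hammingNorm x
    have hR : 0 ≤ (k : ℝ) * g (k - 1) + (n - k) * g (k + 1) :=
      add_nonneg (mul_nonneg (by positivity) (hg0 _)) (mul_nonneg (by linarith) (hg0 _))
    by_cases hin : a < k ∧ k < a + L
    · obtain ⟨h1, h2⟩ := hin
      obtain ⟨j, hj⟩ : ∃ j, k = j + 1 := ⟨k - 1, by omega⟩
      have h1' : (a : ℝ) ≤ k := by exact_mod_cast h1.le
      have h2' : (k : ℝ) ≤ a + L := by exact_mod_cast h2.le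
      have e1 : g k = θ ^ k * s k := if_pos ⟨by omega, by omega⟩
      have e2 : g (k - 1) = θ ^ j * s j := by
        rw [hj, Nat.add_sub_cancel]; exact if_pos ⟨by omega, by omega⟩
      have e3 : g (k + 1) = θ ^ (k + 1) * s (k + 1) := if_pos ⟨by omega, by omega⟩
      have e4 : s j + s (k + 1) = 2 * s k * Real.cos (Real.pi / L) := by
        have e5 : ((j : ℝ) - a) * (Real.pi / L) =
            ((k : ℝ) - a) * (Real.pi / L) - Real.pi / L := by rw [hj]; push_cast; ring
        have e6 : (((k + 1 : ℕ) : ℝ) - a) * (Real.pi / L) =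
            ((k : ℝ) - a) * (Real.pi / L) + Real.pi / L := by push_cast; ring
        simp only [hs]
        rw [e5, e6, Real.sin_sub, Real.sin_add]; ring
      have p1 := hs0 j (by omega) (by omega)
      have p2 := hs0 (k + 1) (by omega) (by omega)
      rw [e1, e2, e3]
      calc 2 * Real.cos (Real.pi / L) * κ * (θ ^ k * s k)
          = κ * θ ^ k * (s j + s (k + 1)) := by rw [e4]; ring
        _ = a * (θ ^ j * s j) + b * (θ ^ (k + 1) * s (k + 1)) := by
            have q1 : κ * θ ^ k = a * θ ^ j := by rw [hj, pow_succ, ← hκ1]; ring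
            have q2 : κ * θ ^ k = b * θ ^ (k + 1) := by rw [hκ2, pow_succ]; ring
            rw [mul_add]; nth_rewrite 1 [q1]; rw [q2]; ring
        _ ≤ _ := by
            gcongr
            linarith
    · have : g k = 0 := by
        simp only [hg]
        split_ifs with h
        · rcases (by omega : k = a ∨ k = a + L) with h' | h'
          · rw [h']; simp [hs]
          · rw [h']; simp only [hs]; push_cast
            rw [add_sub_cancel_left, mul_div_cancel₀ _ (by positivity : (L : ℝ) ≠ 0)]; simp
        · rfl
      simp only [this, mul_zero]
      exact hR

/-! ### Coset leaders of the repetition code -/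

/-- The sum of `max (y ^ |A|) (y ^ |s \ A|)` over the subsets `A` of `s`. -/
def foldedSum {α : Type*} (y : ℝ) (s : Finset α) : ℝ :=
  ∑ A ∈ s.powerset, max (y ^ A.card) (y ^ (s.card - A.card))

lemma one_add_mul_foldedSum_le {α : Type*} [DecidableEq α] {y : ℝ} {s : Finset α}
    {a : α} (ha : a ∉ s) : (1 + y) * foldedSum y s ≤ foldedSum y (insert a s) := by
  unfold foldedSum
  rw [Finset.sum_powerset_insert ha, Finset.mul_sum, ← Finset.sum_add_distrib]
  refine Finset.sum_le_sum fun A hA => ?_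
  have hA' := Finset.mem_powerset.1 hA
  have hc := Finset.card_le_card hA'
  rw [Finset.card_insert_of_notMem ha, Finset.card_insert_of_notMem fun h => ha (hA' h),
    Nat.add_sub_add_right, Nat.sub_add_comm hc]
  rcases le_total (y ^ A.card) (y ^ (s.card - A.card)) with h | h
  · rw [max_eq_right h]
    calc (1 + y) * y ^ (s.card - A.card)
        = y ^ (s.card - A.card + 1) + y ^ (s.card - A.card) := by ring
      _ ≤ _ := add_le_add (le_max_right _ _) (le_max_right _ _)
  · rw [max_eq_left h]
    calc (1 + y) * y ^ A.card = y ^ A.card + y ^ (A.card + 1) := by ring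
      _ ≤ _ := add_le_add (le_max_left _ _) (le_max_left _ _)

lemma foldedSum_eq_sum_range {α : Type*} (y : ℝ) (s : Finset α) :
    foldedSum y s = ∑ k ∈ Finset.range (s.card + 1),
      (s.card.choose k : ℝ) * max (y ^ k) (y ^ (s.card - k)) := by
  unfold foldedSum
  rw [Finset.sum_powerset_apply_card (fun k => max (y ^ k) (y ^ (s.card - k)))]
  simp

/-- For `0 ≤ y ≤ 1`, twice the weight enumerator of the coset leaders of the repetition code of
length `s`: each coset `{v, v + 1}` is counted once for each of its two elements. -/
def foldedPoly (y : ℝ) (s : ℕ) : ℝ :=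
  ∑ k ∈ Finset.range (s + 1), (s.choose k : ℝ) * max (y ^ k) (y ^ (s - k))

lemma foldedSum_eq {α : Type*} (y : ℝ) (s : Finset α) : foldedSum y s = foldedPoly y s.card :=
  foldedSum_eq_sum_range y s

lemma one_add_mul_foldedPoly_le (y : ℝ) (s : ℕ) :
    (1 + y) * foldedPoly y s ≤ foldedPoly y (s + 1) := by
  have := one_add_mul_foldedSum_le (y := y) (Finset.notMem_range_self (n := s))
  rwa [foldedSum_eq, foldedSum_eq, Finset.card_insert_of_notMem Finset.notMem_range_self,
    Finset.card_range] at this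

lemma foldedPoly_le {y : ℝ} (hy : 0 ≤ y) (s : ℕ) : foldedPoly y s ≤ 2 * (1 + y) ^ s := by
  have h1 : foldedPoly y s ≤ ∑ k ∈ Finset.range (s + 1),
      ((s.choose k : ℝ) * y ^ k + s.choose k * y ^ (s - k)) := by
    refine Finset.sum_le_sum fun k _ => ?_
    rw [← mul_add]
    gcongr
    exact max_le_add_of_nonneg (by positivity) (by positivity)
  have h2 : ∑ k ∈ Finset.range (s + 1), (s.choose k : ℝ) * y ^ k = (1 + y) ^ s := by
    rw [add_comm 1 y, add_pow]; simp [mul_comm]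
  have h3 : ∑ k ∈ Finset.range (s + 1), (s.choose k : ℝ) * y ^ (s - k) = (1 + y) ^ s := by
    rw [add_pow]; simp [mul_comm]
  rw [Finset.sum_add_distrib, h2, h3] at h1
  linarith

lemma foldedPoly_pos {y : ℝ} (hy : 0 ≤ y) (s : ℕ) : 0 < foldedPoly y s := by
  refine Finset.sum_pos' (fun k _ => by positivity) ⟨0, by simp, ?_⟩
  simp

/-- `foldedPoly y s` divided by `2 (1 + y) ^ s`, the value of the sum when each maximum is
replaced by the sum of its two entries. -/
def foldedRatio (y : ℝ) (s : ℕ) : ℝ := foldedPoly y s / (2 * (1 + y) ^ s)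

/-- With `foldedRatio_le_one`, this is why repair groups shorter than `r + 1` do not help the code:
both a shorter repair relation and a greater number of groups only decrease the bound. -/
lemma foldedRatio_mono {y : ℝ} (hy : 0 ≤ y) : Monotone (foldedRatio y) := by
  refine monotone_nat_of_le_succ fun s => ?_
  unfold foldedRatio
  rw [div_le_div_iff₀ (by positivity) (by positivity), pow_succ]
  nlinarith [one_add_mul_foldedPoly_le y s, show 0 < 2 * (1 + y) ^ s by positivity]

lemma foldedRatio_le_one {y : ℝ} (hy : 0 ≤ y) (s : ℕ) : foldedRatio y s ≤ 1 :=
  div_le_one_of_le₀ (foldedPoly_le hy s) (by positivity)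

lemma foldedRatio_pos {y : ℝ} (hy : 0 ≤ y) (s : ℕ) : 0 < foldedRatio y s :=
  div_pos (foldedPoly_pos hy s) (by positivity)

/-- The terms `k` and `r + 1 - k` agree; folding them together halves the middle term when `r + 1`
is even, which is the reason for the definition of `bcoef`. -/
lemma foldedPoly_succ_eq (r : ℕ) {y : ℝ} (hy : 0 ≤ y) (hy1 : y ≤ 1) :
    foldedPoly y (r + 1) = 2 * ∑ i ∈ Finset.range (tt r + 1), bcoef r i * y ^ i := by
  have hanti : ∀ {a b : ℕ}, a ≤ b → y ^ b ≤ y ^ a := fun h => pow_le_pow_of_le_one hy hy1 h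
  set F : ℕ → ℝ := fun k => ((r + 1).choose k : ℝ) * max (y ^ k) (y ^ (r + 1 - k)) with hF
  have hsymm : ∀ k ≤ r + 1, F (r + 1 - k) = F k := by
    intro k hk
    simp only [hF]
    rw [Nat.choose_symm hk, Nat.sub_sub_self hk, max_comm]
  have hlow : ∀ k, 2 * k ≤ r + 1 → F k = (r + 1).choose k * y ^ k := by
    intro k hk
    simp only [hF]
    rw [max_eq_left (hanti (by omega))]
  have hb : ∀ i < tt r, bcoef r i = (r + 1).choose i := fun i hi => by simp [bcoef, hi]
  have hlowsum : ∑ i ∈ Finset.range (tt r), bcoef r i * y ^ i = ∑ i ∈ Finset.range (tt r), F i := by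
    refine Finset.sum_congr rfl fun i hi => ?_
    have hi' := Finset.mem_range.1 hi
    rw [hb i hi', hlow i (by unfold tt at hi'; omega)]
  have hP : foldedPoly y (r + 1) = ∑ k ∈ Finset.range (r + 2), F k := rfl
  have hrefl : ∀ m N, N + m = r + 2 → ∑ k ∈ Finset.range m, F (N + k) =
      ∑ k ∈ Finset.range m, F k := by
    intro m N hN
    rw [← Finset.sum_range_reflect]
    refine Finset.sum_congr rfl fun k hk => ?_
    have := Finset.mem_range.1 hk
    rw [← hsymm k (by omega)]
    congr 1; omega
  rw [Finset.sum_range_succ, hlowsum, hP]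
  rcases Nat.even_or_odd' r with ⟨q, h | h⟩
  · have ht : tt r = q := by unfold tt; omega
    have hbt : bcoef r (tt r) = (r + 1).choose (tt r) := by
      simp [bcoef, h]
    rw [hbt, ← hlow (tt r) (by omega), ← Finset.sum_range_succ, ht,
      show r + 2 = (q + 1) + (q + 1) by omega, Finset.sum_range_add,
      hrefl (q + 1) (q + 1) (by omega)]
    ring
  · have ht : tt r = q + 1 := by unfold tt; omega
    have hbt : bcoef r (tt r) = (r + 1).choose (tt r) / 2 := by
      have : r % 2 = 1 := by omega
      simp [bcoef, this]
    rw [hbt, div_mul_eq_mul_div, ← hlow (tt r) (by omega), ht,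
      show r + 2 = (q + 1 + 1) + (q + 1) by omega, Finset.sum_range_add,
      hrefl (q + 1) (q + 1 + 1) (by omega), Finset.sum_range_succ]
    ring

/-! ### Points covered by translates of a ball -/

/-- Binary vectors correspond to their supports. -/
def vecEquivFinset (α : Type*) [Fintype α] [DecidableEq α] : (α → ZMod 2) ≃ Finset α where
  toFun v := Finset.univ.filter fun i => v i ≠ 0
  invFun A i := if i ∈ A then 1 else 0
  left_inv v := by
    funext i
    have h : ∀ a : ZMod 2, a ≠ 0 → a = 1 := by decide
    by_cases hi : v i = 0
    · simp [hi]
    · simp [h _ hi]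
  right_inv A := by ext i; simp

lemma sum_max_ones {α : Type*} [Fintype α] [DecidableEq α] (y : ℝ) :
    ∑ v : α → ZMod 2, max (y ^ hammingNorm v) (y ^ hammingNorm (v + 1)) =
      foldedPoly y (Fintype.card α) := by
  rw [show Fintype.card α = (Finset.univ : Finset α).card from rfl, ← foldedSum_eq, foldedSum,
    Finset.powerset_univ, ← Equiv.sum_comp (vecEquivFinset α)]
  refine Finset.sum_congr rfl fun v _ => ?_
  have h1 : hammingNorm v = (vecEquivFinset α v).card := rfl
  have h2 : hammingNorm (v + 1) = (Finset.univ : Finset α).card - (vecEquivFinset α v).card := by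
    rw [Finset.card_univ, ← Finset.card_compl]
    unfold hammingNorm
    congr 1
    ext i
    have h : ∀ a : ZMod 2, (a + 1 ≠ 0) ↔ ¬ (a ≠ 0) := by decide
    simp only [Finset.mem_filter, Finset.mem_univ, true_and, Finset.mem_compl, vecEquivFinset,
      Equiv.coe_fn_mk, Pi.add_apply, Pi.one_apply]
    exact h (v i)
  rw [h1, h2]

lemma sum_pow_hammingNorm {α : Type*} [Fintype α] [DecidableEq α] (y : ℝ) :
    ∑ v : α → ZMod 2, y ^ hammingNorm v = (1 + y) ^ Fintype.card α := by
  have := Finset.sum_pow_mul_eq_add_pow y 1 (Finset.univ : Finset α)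
  rw [Finset.card_univ, add_comm] at this
  rw [← this, Finset.powerset_univ, ← Equiv.sum_comp (vecEquivFinset α)]
  simp [vecEquivFinset, hammingNorm]

lemma hammingNorm_eq_add_subtype {α : Type*} [Fintype α] (p : α → Prop)
    [DecidablePred p] (v : α → ZMod 2) :
    hammingNorm v = hammingNorm (fun i : {i // p i} => v i) +
      hammingNorm (fun i : {i // ¬ p i} => v i) := by
  simp only [hammingNorm, Finset.card_filter]
  exact (Fintype.sum_subtype_add_sum_subtype p fun i => if v i ≠ 0 then 1 else 0).symm

/-- The coordinates outside the support of `w` contribute a factor `1 + y` each, and on the support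
`w` is the all-one vector. -/
lemma sum_max_pow_hammingNorm {α : Type*} [Fintype α] [DecidableEq α] {y : ℝ} (hy : 0 ≤ y)
    (w : α → ZMod 2) :
    ∑ v : α → ZMod 2, max (y ^ hammingNorm v) (y ^ hammingNorm (v + w)) =
      2 * foldedRatio y (hammingNorm w) * (1 + y) ^ Fintype.card α := by
  have e1 : ∀ v : α → ZMod 2, max (y ^ hammingNorm v) (y ^ hammingNorm (v + w)) =
      max (y ^ hammingNorm (fun i : {i // w i ≠ 0} => v i))
          (y ^ hammingNorm ((fun i : {i // w i ≠ 0} => v i) + 1)) *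
        y ^ hammingNorm (fun i : {i // ¬ w i ≠ 0} => v i) := by
    intro v
    have h : ∀ a : ZMod 2, a ≠ 0 → a = 1 := by decide
    rw [hammingNorm_eq_add_subtype (fun i => w i ≠ 0) v,
      hammingNorm_eq_add_subtype (fun i => w i ≠ 0) (v + w), pow_add, pow_add]
    have h1 : (fun i : {i // w i ≠ 0} => (v + w) i) = (fun i : {i // w i ≠ 0} => v i) + 1 := by
      funext i; simp [h _ i.2]
    have h2 : (fun i : {i // ¬ w i ≠ 0} => (v + w) i) = fun i : {i // ¬ w i ≠ 0} => v i := by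
      funext i; simp [not_not.1 i.2]
    rw [h1, h2, max_mul_of_nonneg _ _ (by positivity)]
  simp_rw [e1]
  rw [← (Equiv.piEquivPiSubtypeProd (fun i => w i ≠ 0) (fun _ => ZMod 2)).symm.sum_comp,
    Fintype.sum_prod_type]
  have e2 : ∀ (a : {i // w i ≠ 0} → ZMod 2) (b : {i // ¬ w i ≠ 0} → ZMod 2),
      (fun i : {i // w i ≠ 0} =>
        (Equiv.piEquivPiSubtypeProd (fun i => w i ≠ 0) (fun _ => ZMod 2)).symm (a, b) i) = a ∧
      (fun i : {i // ¬ w i ≠ 0} =>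
        (Equiv.piEquivPiSubtypeProd (fun i => w i ≠ 0) (fun _ => ZMod 2)).symm (a, b) i) = b := by
    intro a b
    constructor
    · funext i; simp [Equiv.piEquivPiSubtypeProd, i.2]
    · funext i; simp [Equiv.piEquivPiSubtypeProd, not_not.1 i.2]
  simp_rw [(e2 _ _).1, (e2 _ _).2]
  simp_rw [← Finset.mul_sum, ← Finset.sum_mul]
  rw [sum_max_ones, sum_pow_hammingNorm]
  have c1 : Fintype.card {i // w i ≠ 0} = hammingNorm w := by
    rw [Fintype.card_subtype]; rfl
  have c2 : Fintype.card α = hammingNorm w + Fintype.card {i // ¬ w i ≠ 0} := by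
    rw [← c1, ← Fintype.card_sum]
    exact (Fintype.card_congr (Equiv.sumCompl fun i => w i ≠ 0)).symm
  rw [c1, c2, foldedRatio, pow_add]
  field_simp

section Partition

variable {ι : Type*} [Fintype ι] [DecidableEq ι]

/-- The restriction of `v` to the block `p`, where a partition into blocks is given as the fibres of
a map `π`. -/
def blockPart (π : Fin n → ι) (v : Fin n → ZMod 2) (p : ι) : {i // π i = p} → ZMod 2 :=
  fun i => v i

/-- A vector is the same as the family of its restrictions to the blocks. -/
def blockEquiv (π : Fin n → ι) :
    (Fin n → ZMod 2) ≃ ((p : ι) → {i // π i = p} → ZMod 2) where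
  toFun := blockPart π
  invFun u i := u (π i) ⟨i, rfl⟩
  left_inv v := rfl
  right_inv u := by
    funext p ⟨i, hi⟩
    subst hi
    rfl

lemma hammingNorm_eq_sum_blockPart (π : Fin n → ι) (v : Fin n → ZMod 2) :
    hammingNorm v = ∑ p, hammingNorm (blockPart π v p) := by
  simp only [hammingNorm, Finset.card_filter, blockPart]
  rw [← Fintype.sum_fiberwise π]
  exact Finset.sum_congr rfl fun p _ => (Finset.card_filter _ _).symm

/-- The product over the blocks of the larger of `y ^ |v_p|` and `y ^ |v_p + w_p|`. For `y ≤ 1` it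
is `y ^ m`, where `m` is the least weight in the coset of `v` modulo `LinearMap.range (blockSpan π
w)`. -/
def blockWeight (y : ℝ) (π : Fin n → ι) (w v : Fin n → ZMod 2) : ℝ :=
  ∏ p, max (y ^ hammingNorm (blockPart π v p))
    (y ^ hammingNorm (blockPart π v p + blockPart π w p))

lemma sum_blockWeight {y : ℝ} (hy : 0 ≤ y) (π : Fin n → ι) (w : Fin n → ZMod 2) :
    ∑ v, blockWeight y π w v =
      (∏ p, 2 * foldedRatio y (hammingNorm (blockPart π w p))) * (1 + y) ^ n := by
  have h1 : ∑ v, blockWeight y π w v =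
      ∑ u : (p : ι) → {i // π i = p} → ZMod 2, ∏ p, max (y ^ hammingNorm (u p))
        (y ^ hammingNorm (u p + blockPart π w p)) := by
    rw [← Equiv.sum_comp (blockEquiv π)]; rfl
  have h2 : ∑ p, Fintype.card {i // π i = p} = n := by
    rw [← Fintype.card_sigma, Fintype.card_congr (Equiv.sigmaFiberEquiv π), Fintype.card_fin]
  have h3 := Finset.prod_univ_sum (fun p : ι => (Finset.univ : Finset ({i // π i = p} → ZMod 2)))
    (fun p u => max (y ^ hammingNorm u) (y ^ hammingNorm (u + blockPart π w p)))
  rw [h1, ← Fintype.piFinset_univ, ← h3]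
  simp_rw [sum_max_pow_hammingNorm hy]
  rw [Finset.prod_mul_distrib, Finset.prod_pow_eq_pow_sum, h2]

/-- The combination of the block restrictions of `w` (each extended by zero) with coefficients
`e`. -/
def blockSpan (π : Fin n → ι) (w : Fin n → ZMod 2) : (ι → ZMod 2) →ₗ[ZMod 2] (Fin n → ZMod 2) where
  toFun e i := e (π i) * w i
  map_add' a b := by funext i; simp [add_mul]
  map_smul' a b := by funext i; simp [mul_assoc]

lemma card_range_blockSpan {π : Fin n → ι} {w : Fin n → ZMod 2}
    (hw : ∀ p, ∃ i, π i = p ∧ w i ≠ 0) :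
    Nat.card (LinearMap.range (blockSpan π w)) = 2 ^ Fintype.card ι := by
  have hinj : Function.Injective (blockSpan π w) := by
    intro a b hab
    funext p
    obtain ⟨i, rfl, hi⟩ := hw p
    exact mul_right_cancel₀ hi (congrFun hab i)
  rw [← Nat.card_congr (LinearEquiv.ofInjective _ hinj).toEquiv, Nat.card_eq_fintype_card]
  simp [ZMod.card]

lemma le_blockWeight {y : ℝ} (hy : 0 ≤ y) (π : Fin n → ι) (w x : Fin n → ZMod 2)
    (e : ι → ZMod 2) : y ^ hammingNorm x ≤ blockWeight y π w (x + blockSpan π w e) := by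
  rw [hammingNorm_eq_sum_blockPart π, ← Finset.prod_pow_eq_pow_sum, blockWeight]
  refine Finset.prod_le_prod (fun _ _ => by positivity) fun p _ => ?_
  have h : ∀ a : ZMod 2, a = 0 ∨ a = 1 := by decide
  rcases h (e p) with he | he
  · have : blockPart π (x + blockSpan π w e) p = blockPart π x p := by
      funext ⟨i, hi⟩; simp [blockPart, blockSpan, hi, he]
    rw [this]; exact le_max_left _ _
  · have : blockPart π (x + blockSpan π w e) p + blockPart π w p = blockPart π x p := by
      funext ⟨i, hi⟩
      simp [blockPart, blockSpan, hi, he, add_assoc, CharTwo.add_self_eq_zero]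
    rw [this]; exact le_max_right _ _

/-- A bound for the number of points in the translates of a ball of radius `m` by the span of the
block restrictions of `w`: on each of them `blockWeight` is at least `y ^ m`. -/
theorem card_covered_le {r : ℕ} {y : ℝ} (hy : 0 < y) {π : Fin n → ι}
    {w : Fin n → ZMod 2} (hw : ∀ p, hammingNorm (blockPart π w p) ≤ r + 1)
    {m : ℕ} {S : Finset (Fin n → ZMod 2)} (hy1 : y ≤ 1)
    (hS : ∀ v ∈ S, ∃ x, hammingNorm x ≤ m ∧ ∃ e, v = x + blockSpan π w e) :
    (S.card : ℝ) * y ^ m ≤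
      (2 * foldedRatio y (r + 1)) ^ Fintype.card ι * (1 + y) ^ n := by
  calc (S.card : ℝ) * y ^ m = ∑ _v ∈ S, y ^ m := by simp
    _ ≤ ∑ v ∈ S, blockWeight y π w v := by
        refine Finset.sum_le_sum fun v hv => ?_
        obtain ⟨x, hx, e, rfl⟩ := hS v hv
        exact (pow_le_pow_of_le_one hy.le hy1 hx).trans (le_blockWeight hy.le π w x e)
    _ ≤ ∑ v, blockWeight y π w v :=
        Finset.sum_le_sum_of_subset_of_nonneg (Finset.subset_univ S) fun v _ _ =>
          Finset.prod_nonneg fun p _ => by positivity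
    _ ≤ _ := by
        rw [sum_blockWeight hy.le]
        gcongr
        rw [← Finset.card_univ, ← Finset.prod_const]
        refine Finset.prod_le_prod (fun p _ => ?_) fun p _ => ?_
        · exact mul_nonneg zero_le_two (foldedRatio_pos hy.le _).le
        · gcongr; exact foldedRatio_mono hy.le (hw p)

end Partition

/-! ### Dual words from repair groups -/

/-- For a linear code, a codeword that vanishes on `R \ {i}` vanishes at `i`, whatever the repair
function is. So the `i`-th coordinate is a linear combination of the other ones in `R`, which
gives a word of the dual code that is supported in `R` and is nonzero at `i`. -/
lemma exists_dual_word_of_isRepairGroup {C : Submodule (ZMod 2) (Fin n → ZMod 2)} {i : Fin n}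
    {R : Finset (Fin n)} (h : IsRepairGroup (C : Set (Fin n → ZMod 2)) i R) :
    ∃ w : Fin n → ZMod 2, w i ≠ 0 ∧ (∀ j ∉ R, w j = 0) ∧ ∀ c ∈ C, c ⬝ᵥ w = 0 := by
  obtain ⟨hiR, φ, hφ⟩ := h
  let coord : Fin n → C →ₗ[ZMod 2] ZMod 2 := fun j => (LinearMap.proj j).comp C.subtype
  have hker : ⨅ j : ↥(R.erase i), LinearMap.ker (coord j) ≤ LinearMap.ker (coord i) := by
    intro c hc
    simp only [Submodule.mem_iInf, LinearMap.mem_ker] at hc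
    have h1 : (c : Fin n → ZMod 2) i = φ fun j => (c : Fin n → ZMod 2) j := hφ c c.2
    have h2 : (0 : Fin n → ZMod 2) i = φ fun j => (0 : Fin n → ZMod 2) j := hφ 0 C.zero_mem
    have h3 : (fun j : ↥(R.erase i) => (c : Fin n → ZMod 2) j) =
        fun j : ↥(R.erase i) => (0 : Fin n → ZMod 2) j := funext fun j => hc j
    rw [h3, ← h2] at h1
    exact h1
  obtain ⟨b, hb⟩ := (Submodule.mem_span_range_iff_exists_fun (ZMod 2)).1
    (mem_span_of_iInf_ker_le_ker hker)
  refine ⟨fun j => if j = i then 1 else if hj : j ∈ R.erase i then b ⟨j, hj⟩ else 0,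
    by simp, fun j hj => ?_, fun c hc => ?_⟩
  · have h1 : j ≠ i := by rintro rfl; exact hj hiR
    simp [h1, hj]
  · have h1 := LinearMap.congr_fun hb ⟨c, hc⟩
    simp only [LinearMap.sum_apply, LinearMap.smul_apply, coord, LinearMap.comp_apply,
      LinearMap.proj_apply, Submodule.subtype_apply, smul_eq_mul] at h1
    have h2 : ∀ j, c j * (if j = i then 1 else
        if hj : j ∈ R.erase i then b ⟨j, hj⟩ else 0) =
        (if j = i then c j else 0) +
          if hj : j ∈ R.erase i then b ⟨j, hj⟩ * c j else 0 := by
      intro j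
      by_cases hj : j = i
      · subst hj; simp
      · by_cases hR : j ∈ R.erase i
        · simp only [hj, hR, if_false, dif_pos, zero_add, mul_comm]
        · simp only [hj, hR, if_false, dif_neg, not_false_eq_true, zero_add, mul_zero]
    have h3 : ∑ j, (if hj : j ∈ R.erase i then b ⟨j, hj⟩ * c j else 0) =
        ∑ j : ↥(R.erase i), b j * c j := by
      rw [← Finset.sum_subset (Finset.subset_univ (R.erase i)), ← Finset.sum_coe_sort]
      · exact Finset.sum_congr rfl fun j _ => dif_pos j.2
      · intro j _ hj
        exact dif_neg hj
    rw [dotProduct, Finset.sum_congr rfl fun j _ => h2 j, Finset.sum_add_distrib, h3, h1]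
    simp [CharTwo.add_self_eq_zero]

/-- The chosen repair groups partition the coordinates. The word `w` is put together from one
nonzero dual word for each group. -/
theorem exists_partition_of_hasDisjointRepairGroups {r : ℕ}
    {C : Submodule (ZMod 2) (Fin n → ZMod 2)}
    (h : HasDisjointRepairGroups (C : Set (Fin n → ZMod 2)) r) :
    ∃ (P : Finset (Finset (Fin n))) (π : Fin n → P) (w : Fin n → ZMod 2),
      n ≤ P.card * (r + 1) ∧ (∀ p, ∃ i, π i = p ∧ w i ≠ 0) ∧
      (∀ p, hammingNorm (blockPart π w p) ≤ r + 1) ∧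
      ∀ c ∈ C, ∀ z ∈ LinearMap.range (blockSpan π w), c ⬝ᵥ z = 0 := by
  obtain ⟨R, hR, hdisj⟩ := h
  have hmem : ∀ i, i ∈ R i := fun i => (hR i).1.1
  have heq : ∀ i j, i ∈ R j → R i = R j := by
    intro i j hij
    by_contra hne
    exact Finset.disjoint_left.1 (hdisj i j hne) (hmem i) hij
  set P := Finset.univ.image R with hP
  set π : Fin n → P := fun i => ⟨R i, Finset.mem_image_of_mem R (Finset.mem_univ i)⟩ with hπ
  have hsurj : ∀ p : P, ∃ i, π i = p := by
    intro p
    obtain ⟨i, -, hi⟩ := Finset.mem_image.1 p.2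
    exact ⟨i, Subtype.ext hi⟩
  have hfib : ∀ (p : P) (i : Fin n), i ∈ (p : Finset (Fin n)) ↔ π i = p := by
    intro p i
    obtain ⟨j, rfl⟩ := hsurj p
    exact ⟨fun hi => Subtype.ext (heq i j hi),
      fun hi => by rw [← hi]; exact hmem i⟩
  have hcard : ∀ p : P, Fintype.card {i // π i = p} ≤ r + 1 := by
    intro p
    obtain ⟨j, hj⟩ := hsurj p
    have : Fintype.card {i // π i = p} = (R j).card := by
      rw [← Fintype.card_coe]
      refine Fintype.card_congr (Equiv.subtypeEquivRight fun i => ?_)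
      rw [← hfib p i, ← hj]
    rw [this]
    exact (hR j).2
  have hword : ∀ p : P, ∃ w : Fin n → ZMod 2, (∃ i, π i = p ∧ w i ≠ 0) ∧
      (∀ j, π j ≠ p → w j = 0) ∧ ∀ c ∈ C, c ⬝ᵥ w = 0 := by
    intro p
    obtain ⟨j, hj⟩ := hsurj p
    obtain ⟨w, h1, h2, h3⟩ := exists_dual_word_of_isRepairGroup (hR j).1
    refine ⟨w, ⟨j, hj, h1⟩, fun k hk => h2 k fun hk' => hk ?_, h3⟩
    rw [← hj]; exact (hfib (π j) k).1 hk'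
  choose u hu1 hu2 hu3 using hword
  refine ⟨P, π, fun i => u (π i) i, ?_, ?_, ?_, ?_⟩
  · have h1 : n = ∑ p : P, Fintype.card {i // π i = p} := by
      rw [← Fintype.card_sigma, Fintype.card_congr (Equiv.sigmaFiberEquiv π), Fintype.card_fin]
    have h2 := Finset.sum_le_card_nsmul (Finset.univ : Finset P) _ _ fun p _ => hcard p
    rw [← h1] at h2
    simpa using h2
  · intro p
    obtain ⟨i, hi, hi'⟩ := hu1 p
    subst hi
    exact ⟨i, rfl, hi'⟩
  · intro p
    exact hammingNorm_le_card_fintype.trans (hcard p)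
  · rintro c hc _ ⟨e, rfl⟩
    have h1 : blockSpan π (fun i => u (π i) i) e = ∑ p, e p • u p := by
      funext i
      rw [Finset.sum_apply, Finset.sum_eq_single (π i)]
      · rfl
      · intro p _ hp
        simp [hu2 p i hp.symm]
      · simp
    rw [h1, dotProduct_sum]
    exact Finset.sum_eq_zero fun p _ => by rw [dotProduct_smul, hu3 p c hc, smul_zero]

/-! ### The polynomials and their positive zeros -/

lemma bcoef_pos {r i : ℕ} (hi : i ≤ tt r) : 0 < bcoef r i := by
  have : 0 < (r + 1).choose i := Nat.choose_pos (by unfold tt at hi; omega)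
  unfold bcoef
  split_ifs <;> positivity

lemma bcoef_le_choose (r i : ℕ) : bcoef r i ≤ (r + 1).choose i := by
  unfold bcoef
  split_ifs
  · exact le_rfl
  · exact div_le_self (by positivity) (one_le_pow₀ one_le_two)

lemma eval_rootPoly (r : ℕ) (δ : ℝ) (w : ℕ → ℝ) (x : ℝ) :
    (rootPoly r δ w).eval x =
      ∑ i ∈ Finset.range (tt r + 1), w i * (((r : ℝ) + 1) * tau δ - i) * x ^ (tt r - i) := by
  simp only [rootPoly, Polynomial.eval_sub, Polynomial.eval_mul, Polynomial.eval_C,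
    Polynomial.eval_finsetSum, Polynomial.eval_pow, Polynomial.eval_X]
  rw [Finset.mul_sum, ← Finset.sum_sub_distrib]
  exact Finset.sum_congr rfl fun i _ => by ring

/-- After multiplication by `x ^ (a - t)` the `i`-th term is `w i * (a - i) * x ^ (a - i)`, which is
increasing in `x` whatever the sign of `a - i`. So the sum has at most one positive zero. -/
lemma strictMonoOn_scaled_sum {t : ℕ} {w : ℕ → ℝ} (hw : ∀ i ≤ t, 0 < w i) {a : ℝ} (ha : 0 < a) :
    StrictMonoOn (fun x : ℝ => x ^ (a - t) *
      ∑ i ∈ Finset.range (t + 1), w i * (a - i) * x ^ (t - i)) (Set.Ioi 0) := by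
  have hmono : ∀ i : ℕ, a ≠ i → ∀ x : ℝ, 0 < x → ∀ y : ℝ, x < y →
      (a - i) * x ^ (a - i) < (a - i) * y ^ (a - i) := by
    intro i hi x hx y hxy
    rcases lt_or_gt_of_ne hi with h | h
    · exact mul_lt_mul_of_neg_left (Real.rpow_lt_rpow_of_neg hx hxy (by linarith)) (by linarith)
    · exact mul_lt_mul_of_pos_left (Real.rpow_lt_rpow hx.le hxy (by linarith)) (by linarith)
  have heq : ∀ x : ℝ, 0 < x → x ^ (a - t) *
      ∑ i ∈ Finset.range (t + 1), w i * (a - i) * x ^ (t - i) =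
      ∑ i ∈ Finset.range (t + 1), w i * ((a - i) * x ^ (a - i)) := by
    intro x hx
    rw [Finset.mul_sum]
    refine Finset.sum_congr rfl fun i hi => ?_
    have hi' : i ≤ t := by have := Finset.mem_range.1 hi; omega
    have : x ^ (a - i) = x ^ (a - t) * x ^ (t - i) := by
      rw [← Real.rpow_natCast, ← Real.rpow_add hx]
      push_cast [hi']
      ring_nf
    rw [this]; ring
  intro x hx y hy hxy
  simp only [heq x hx, heq y hy]
  refine Finset.sum_lt_sum (fun i hi => ?_) ⟨0, by simp, ?_⟩
  · have hi' : i ≤ t := by have := Finset.mem_range.1 hi; omega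
    refine mul_le_mul_of_nonneg_left ?_ (hw i hi').le
    by_cases h : a = i
    · simp [h]
    · exact (hmono i h x hx y hxy).le
  · exact mul_lt_mul_of_pos_left (hmono 0 (by simpa using ha.ne') x hx y hxy) (hw 0 (by omega))

/-- The zero exists because the leading coefficient `w 0 * (r + 1) * tau δ` is positive. -/
theorem exists_isUniquePosRoot {r : ℕ} {δ : ℝ} {w : ℕ → ℝ} (hw : ∀ i ≤ tt r, 0 < w i)
    (hτ : 0 < tau δ) (h1 : (rootPoly r δ w).eval 1 < 0) :
    ∃ μ, 1 < μ ∧ IsUniquePosRoot (rootPoly r δ w) μ := by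
  set a : ℝ := ((r : ℝ) + 1) * tau δ with ha
  have ha0 : 0 < a := by positivity
  set p := rootPoly r δ w
  have hlead : 0 < w 0 * a := mul_pos (hw 0 (by omega)) ha0
  obtain ⟨x, hx1, hx⟩ : ∃ x : ℝ, 1 ≤ x ∧ 0 ≤ p.eval x := by
    set s : ℝ := ∑ i ∈ Finset.range (tt r), w (i + 1) * (((i + 1 : ℕ) : ℝ)) with hs
    refine ⟨max 1 (s / (w 0 * a)), le_max_left _ _, ?_⟩
    set x := max 1 (s / (w 0 * a)) with hxdef
    have hx1 : 1 ≤ x := le_max_left _ _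
    have hxs : s ≤ w 0 * a * x := by
      have : s / (w 0 * a) ≤ x := le_max_right _ _
      rwa [div_le_iff₀' hlead] at this
    rw [eval_rootPoly, Finset.sum_range_succ']
    have ht : tt r ≠ 0 := by
      intro h0
      rw [eval_rootPoly, h0] at h1
      simp at h1
      linarith
    obtain ⟨t, ht⟩ := Nat.exists_eq_succ_of_ne_zero ht
    have hb : -(s * x ^ t) ≤ ∑ i ∈ Finset.range (tt r),
        w (i + 1) * (a - ((i + 1 : ℕ) : ℝ)) * x ^ (tt r - (i + 1)) := by
      rw [hs, Finset.sum_mul, ← Finset.sum_neg_distrib]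
      refine Finset.sum_le_sum fun i hi => ?_
      have hi' := Finset.mem_range.1 hi
      have hwi := hw (i + 1) (by omega)
      have hpow : x ^ (tt r - (i + 1)) ≤ x ^ t := pow_le_pow_right₀ hx1 (by omega)
      have hp0 : 0 < x ^ (tt r - (i + 1)) := by positivity
      have q1 : 0 ≤ w (i + 1) * a * x ^ (tt r - (i + 1)) := by positivity
      have q2 : w (i + 1) * ((i + 1 : ℕ) : ℝ) * x ^ (tt r - (i + 1)) ≤
          w (i + 1) * ((i + 1 : ℕ) : ℝ) * x ^ t := by gcongr
      linarith
    have hx' : x ^ tt r = x ^ t * x := by rw [ht]; exact pow_succ x t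
    simp only [Nat.cast_zero, sub_zero, Nat.sub_zero, hx']
    have : s * x ^ t ≤ w 0 * a * x * x ^ t := by gcongr
    linarith
  obtain ⟨μ, ⟨hμ1, -⟩, hμ⟩ := intermediate_value_Icc hx1 p.continuous.continuousOn ⟨h1.le, hx⟩
  have hμ1' : 1 < μ := by
    refine lt_of_le_of_ne hμ1 ?_
    rintro rfl
    exact h1.ne hμ
  have hμ0 : 0 < μ := by linarith
  refine ⟨μ, hμ1', ⟨hμ0, hμ⟩, fun y hy0 hy => ?_⟩
  refine (strictMonoOn_scaled_sum hw ha0).injOn hy0 hμ0 ?_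
  simp only [ha]
  rw [← eval_rootPoly, ← eval_rootPoly]
  change _ * p.eval y = _ * p.eval μ
  rw [hy, show p.eval μ = 0 from hμ, mul_zero, mul_zero]

lemma eval_rootPoly_bcoef_one_neg {r : ℕ} {δ : ℝ}
    (h : ¬ betaMean r 1 ≤ ((r : ℝ) + 1) * tau δ) :
    (rootPoly r δ (bcoef r)).eval 1 < 0 := by
  have hS : 0 < ∑ l ∈ Finset.range (tt r + 1), bcoef r l :=
    Finset.sum_pos (fun i hi => bcoef_pos (by have := Finset.mem_range.1 hi; omega)) (by simp)
  have hmean : betaMean r 1 = (∑ i ∈ Finset.range (tt r + 1), (i : ℝ) * bcoef r i) /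
      ∑ l ∈ Finset.range (tt r + 1), bcoef r l := by
    simp only [betaMean, beta, one_pow, div_one, Finset.sum_div, mul_div_assoc]
  rw [not_le, hmean, lt_div_iff₀ hS, Finset.mul_sum] at h
  rw [eval_rootPoly]
  simp only [one_pow, mul_one, mul_sub, Finset.sum_sub_distrib]
  have e1 : ∀ i, bcoef r i * (((r : ℝ) + 1) * tau δ) = ((r : ℝ) + 1) * tau δ * bcoef r i :=
    fun i => mul_comm _ _
  have e2 : ∀ i : ℕ, bcoef r i * (i : ℝ) = i * bcoef r i := fun i => mul_comm _ _
  simp only [e1, e2]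
  linarith

lemma betaMean_one_le (r : ℕ) : betaMean r 1 ≤ tt r := by
  have hS : 0 < ∑ l ∈ Finset.range (tt r + 1), bcoef r l :=
    Finset.sum_pos (fun i hi => bcoef_pos (by have := Finset.mem_range.1 hi; omega)) (by simp)
  simp only [betaMean, beta, one_pow, div_one, ← mul_div_assoc]
  rw [← Finset.sum_div, div_le_iff₀ hS, Finset.mul_sum]
  refine Finset.sum_le_sum fun i hi => ?_
  have hi' : i ≤ tt r := by have := Finset.mem_range.1 hi; omega
  have := bcoef_pos hi'
  gcongr

/-- Passing from `bcoef` to the binomial coefficients can only increase the weight at `i = tt r`,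
where the factor `(r + 1) * tau δ - i` is not positive. -/
lemma eval_rootPoly_choose_one_neg {r : ℕ} {δ : ℝ}
    (h : ¬ betaMean r 1 ≤ ((r : ℝ) + 1) * tau δ) :
    (rootPoly r δ fun i => ((r + 1).choose i : ℝ)).eval 1 < 0 := by
  refine lt_of_le_of_lt ?_ (eval_rootPoly_bcoef_one_neg h)
  rw [eval_rootPoly, eval_rootPoly, Finset.sum_range_succ, Finset.sum_range_succ]
  simp only [one_pow, mul_one]
  have hlt : ((r : ℝ) + 1) * tau δ - tt r ≤ 0 := by linarith [betaMean_one_le r]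
  refine add_le_add (le_of_eq ?_) ?_
  · refine Finset.sum_congr rfl fun i hi => ?_
    simp [bcoef, Finset.mem_range.1 hi]
  · exact mul_le_mul_of_nonpos_right (bcoef_le_choose r _) hlt

/-! ### The asymptotic bound -/

lemma sum_beta_eq (r : ℕ) (x : ℝ) : ∑ i ∈ Finset.range (tt r + 1), beta r i x =
    ∑ i ∈ Finset.range (tt r + 1), bcoef r i * x⁻¹ ^ i := by
  simp [beta, div_eq_mul_inv]

lemma sum_beta_pos (r : ℕ) {x : ℝ} (hx : 0 < x) :
    0 < ∑ i ∈ Finset.range (tt r + 1), beta r i x :=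
  Finset.sum_pos (fun i hi => div_pos
    (bcoef_pos (by have := Finset.mem_range.1 hi; omega)) (by positivity)) (by simp)

/-- Here `m` is the number of repair groups. It is at least `n / (r + 1)`, and the base
`foldedRatio` is at most `1`. -/
lemma foldedRatio_pow_mul_le {r m : ℕ} {x : ℝ} (hx : 1 ≤ x) (hm : n ≤ m * (r + 1)) :
    foldedRatio x⁻¹ (r + 1) ^ m * (1 + x⁻¹) ^ n ≤
      (∑ i ∈ Finset.range (tt r + 1), beta r i x) ^ ((n : ℝ) / (r + 1)) := by
  have hx0 : 0 < x := by linarith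
  have hy0 : 0 < x⁻¹ := inv_pos.2 hx0
  have hr : (0 : ℝ) < r + 1 := by positivity
  set u := foldedRatio x⁻¹ (r + 1) with hu
  have hu0 : 0 < u := foldedRatio_pos hy0.le _
  have hu1 : u ≤ 1 := foldedRatio_le_one hy0.le _
  have e1 : ∑ i ∈ Finset.range (tt r + 1), beta r i x = u * (1 + x⁻¹) ^ (r + 1) := by
    rw [hu, foldedRatio, foldedPoly_succ_eq r hy0.le (inv_le_one_of_one_le₀ hx), sum_beta_eq]
    field_simp
  have e2 : ((1 + x⁻¹) ^ (r + 1)) ^ ((n : ℝ) / (r + 1)) = (1 + x⁻¹) ^ n := by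
    rw [← Real.rpow_natCast, ← Real.rpow_mul (by positivity), ← Real.rpow_natCast]
    congr 1
    push_cast
    field_simp
  rw [e1, Real.mul_rpow hu0.le (by positivity), e2]
  gcongr
  rw [← Real.rpow_natCast]
  refine Real.rpow_le_rpow_of_exponent_ge hu0 hu1 ?_
  rw [div_le_iff₀ hr]
  exact_mod_cast hm

/-- One independent parity check for each repair group. -/
theorem card_le_of_hasDisjointRepairGroups {r : ℕ} {C : Submodule (ZMod 2) (Fin n → ZMod 2)}
    (hC : HasDisjointRepairGroups (C : Set (Fin n → ZMod 2)) r) :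
    (Nat.card C : ℝ) ≤
      (∑ i ∈ Finset.range (tt r + 1), beta r i 1) ^ ((n : ℝ) / (r + 1)) := by
  obtain ⟨P, π, w, hn, hw, -, horth⟩ := exists_partition_of_hasDisjointRepairGroups hC
  refine le_trans ?_ (foldedRatio_pow_mul_le le_rfl hn)
  have hu : foldedRatio (1 : ℝ)⁻¹ (r + 1) = 1 / 2 := by
    have : foldedPoly 1 (r + 1) = 2 ^ (r + 1) := by
      simp only [foldedPoly, one_pow, max_self, mul_one]
      exact_mod_cast Nat.sum_range_choose (r + 1)
    rw [inv_one, foldedRatio, this]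
    norm_num
    field_simp
  have h := card_mul_card_le_two_pow C _ horth
  rw [card_range_blockSpan hw, Fintype.card_coe] at h
  rw [hu]
  push_cast at h
  rw [one_div, inv_pow, inv_mul_eq_div, le_div_iff₀ (by positivity)]
  rw [inv_one, one_add_one_eq_two]
  exact h

/-- The bound for fixed length. The hypothesis `hlam` asks that the ball of radius `a + L` has an
approximate eigenvalue of at least `n - 2 d + 1`. -/
theorem card_le_of_minDistGE {r a L : ℕ} {C : Submodule (ZMod 2) (Fin n → ZMod 2)}
    (hC : HasDisjointRepairGroups (C : Set (Fin n → ZMod 2)) r) {d x : ℝ} (hd0 : 0 ≤ d)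
    (hd : MinDistGE (C : Set (Fin n → ZMod 2)) d) (hx : 1 ≤ x)
    (ha : 1 ≤ a) (hL : 2 ≤ L) (haL : a + L < n)
    (hlam : n - 2 * d + 1 ≤ 2 * Real.cos (Real.pi / L) * Real.sqrt (a * (n - a - L))) :
    (Nat.card C : ℝ) ≤ 2 * d * x ^ (a + L) *
      (∑ i ∈ Finset.range (tt r + 1), beta r i x) ^ ((n : ℝ) / (r + 1)) := by
  classical
  obtain ⟨P, π, w, hn, hw, hw1, horth⟩ := exists_partition_of_hasDisjointRepairGroups hC
  obtain ⟨f, hf, hpos, hsupp, hadj⟩ := exists_ball_function ha hL haL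
  have hwt : ∀ c ∈ C, c ≠ 0 → d ≤ (hammingNorm c : ℝ) := by
    intro c hc hc0
    have := hd c hc 0 C.zero_mem hc0
    rwa [hammingDist_zero_right] at this
  have hK : ∑ c : C, fhat f c ^ 2 ≤ 2 * d * fhat f 0 ^ 2 := by
    have h1 := sum_sq_fhat_le C hf hadj hwt
    have h2 : 0 ≤ ∑ c : C, fhat f (c : Fin n → ZMod 2) ^ 2 :=
      Finset.sum_nonneg fun _ _ => sq_nonneg _
    nlinarith
  set S : Finset (Fin n → ZMod 2) := Finset.univ.filter fun v =>
    ∃ x, hammingNorm x ≤ a + L ∧ ∃ e, v = x + blockSpan π w e with hS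
  have h1 := card_mul_card_le C (LinearMap.range (blockSpan π w)) horth hf hpos (S := S)
    (by
      rintro x hx _ ⟨e, rfl⟩
      rw [hS, Finset.mem_filter]
      exact ⟨Finset.mem_univ _, x, hsupp x hx, e, rfl⟩) hK
  have hx0 : 0 < x := by linarith
  have hy0 : 0 < x⁻¹ := inv_pos.2 hx0
  have h2 := card_covered_le hy0 hw1 (inv_le_one_of_one_le₀ hx) (S := S) (m := a + L)
    (fun v hv => (Finset.mem_filter.1 hv).2)
  rw [card_range_blockSpan hw] at h1
  rw [Fintype.card_coe] at h1 h2
  push_cast at h1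
  have h3 := foldedRatio_pow_mul_le hx hn
  set u := foldedRatio x⁻¹ (r + 1)
  have h4 : (S.card : ℝ) ≤ (2 * u) ^ P.card * (1 + x⁻¹) ^ n * x ^ (a + L) := by
    rwa [inv_pow, ← div_eq_mul_inv, div_le_iff₀ (by positivity)] at h2
  have h5 : (Nat.card C : ℝ) * 2 ^ P.card ≤
      (2 * d * x ^ (a + L) * (u ^ P.card * (1 + x⁻¹) ^ n)) * 2 ^ P.card := by
    refine h1.trans ((mul_le_mul_of_nonneg_left h4 (by positivity)).trans (le_of_eq ?_))
    rw [mul_pow]; ring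
  exact (le_of_mul_le_mul_right h5 (by positivity)).trans
    (mul_le_mul_of_nonneg_left h3 (by positivity))

lemma maxCard_le {r : ℕ} {d K : ℝ} (hK : 0 ≤ K)
    (h : ∀ C : Submodule (ZMod 2) (Fin n → ZMod 2),
      HasDisjointRepairGroups (C : Set (Fin n → ZMod 2)) r →
      MinDistGE (C : Set (Fin n → ZMod 2)) d → (Nat.card C : ℝ) ≤ K) :
    (maxCard n r d : ℝ) ≤ K := by
  refine le_trans (Nat.cast_le.2 (csSup_le' (a := ⌊K⌋₊) ?_)) (Nat.floor_le hK)
  rintro M ⟨C, h1, h2, rfl⟩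
  exact Nat.le_floor (h C h1 h2)

/-- The zero code is admissible, so that logarithms of `maxCard` take no junk value. -/
lemma maxCard_pos (n r : ℕ) (d : ℝ) : 0 < maxCard n r d := by
  have hbdd : BddAbove {M : ℕ | ∃ C : Submodule (ZMod 2) (Fin n → ZMod 2),
      HasDisjointRepairGroups (C : Set (Fin n → ZMod 2)) r ∧
      MinDistGE (C : Set (Fin n → ZMod 2)) d ∧ Nat.card C = M} := by
    refine ⟨Nat.card (Fin n → ZMod 2), ?_⟩
    rintro M ⟨C, -, -, rfl⟩
    exact Nat.card_le_card_of_injective _ Subtype.val_injective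
  refine lt_of_lt_of_le zero_lt_one (le_csSup hbdd ⟨⊥, ⟨fun i => {i}, ?_, ?_⟩, ?_, by simp⟩)
  · refine fun i => ⟨⟨by simp, fun _ => 0, ?_⟩, by simp⟩
    rintro c hc
    rw [SetLike.mem_coe, Submodule.mem_bot] at hc
    simp [hc]
  · intro i j hij
    rw [Finset.disjoint_singleton]
    rintro rfl
    exact hij rfl
  · intro x hx y hy hxy
    rw [SetLike.mem_coe, Submodule.mem_bot] at hx hy
    exact absurd (hx.trans hy.symm) hxy

lemma asympRate_le_of_tendsto {r : ℕ} {δ B : ℝ} {K : ℕ → ℝ}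
    (hK : ∀ᶠ n in Filter.atTop, (maxCard n r (δ * n) : ℝ) ≤ K n)
    (hB : Filter.Tendsto (fun n : ℕ => Real.logb 2 (K n) / n) Filter.atTop (nhds B)) :
    asympRate r δ ≤ B := by
  rw [asympRate, ← hB.limsup_eq]
  have hone : ∀ n : ℕ, (1 : ℝ) ≤ maxCard n r (δ * n) := fun n => by
    exact_mod_cast maxCard_pos n r (δ * n)
  refine Filter.limsup_le_limsup ?_ ?_ hB.isBoundedUnder_le
  · filter_upwards [hK] with n hn
    gcongr
    · norm_num
    · linarith [hone n]
  · refine Filter.isCoboundedUnder_le_of_le (x := 0) _ fun n => ?_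
    exact div_nonneg (Real.logb_nonneg one_lt_two (hone n)) (by positivity)

theorem asympRate_le_rateBound_one (r : ℕ) (δ : ℝ) : asympRate r δ ≤ rateBound r δ 1 := by
  set s := ∑ i ∈ Finset.range (tt r + 1), beta r i 1 with hs
  have hs0 : 0 < s := sum_beta_pos r one_pos
  refine asympRate_le_of_tendsto (K := fun n => s ^ ((n : ℝ) / (r + 1)))
    (Filter.Eventually.of_forall fun n => maxCard_le (by positivity) fun C hC _ =>
      card_le_of_hasDisjointRepairGroups hC) ?_
  refine tendsto_const_nhds.congr' ?_
  filter_upwards [Filter.eventually_gt_atTop 0] with n hn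
  have : (n : ℝ) ≠ 0 := by positivity
  rw [Real.logb_rpow_eq_mul_logb_of_pos hs0, rateBound, Real.logb_one, mul_zero, zero_add]
  field_simp
  rfl

lemma tau_pos {δ : ℝ} (hδ : δ < 1 / 2) : 0 < tau δ := by
  have : Real.sqrt (δ * (1 - δ)) < 1 / 2 := by
    rw [Real.sqrt_lt' (by norm_num)]
    nlinarith [sq_pos_of_pos (sub_pos.2 hδ)]
  unfold tau; linarith

lemma tau_lt_half {δ : ℝ} (hδ₀ : 0 < δ) (hδ : δ < 1 / 2) : tau δ < 1 / 2 := by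
  have : 0 < Real.sqrt (δ * (1 - δ)) := Real.sqrt_pos.2 (mul_pos hδ₀ (by linarith))
  unfold tau; linarith

/-- There is equality at `ρ = tau δ`; this is where the value of `tau` comes from. -/
lemma one_sub_two_mul_lt {δ ρ : ℝ} (hδ₀ : 0 < δ) (hδ : δ < 1 / 2) (h1 : tau δ < ρ)
    (h2 : ρ < 1 / 2) : 1 - 2 * δ < 2 * Real.sqrt (ρ * (1 - ρ)) := by
  have hq : Real.sqrt (δ * (1 - δ)) ^ 2 = δ * (1 - δ) :=
    Real.sq_sqrt (mul_nonneg hδ₀.le (by linarith))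
  have : 1 / 2 - δ < Real.sqrt (ρ * (1 - ρ)) := by
    apply Real.lt_sqrt_of_sq_lt
    unfold tau at h1
    nlinarith
  linarith

/-- Balls of radius `a + L` with `a = ⌊ρ n⌋` and `L` fixed: the eigenvalue of
`exists_ball_function` is asymptotically `2 cos (π / L) √(ρ (1 - ρ)) n`, which beats `(1 - 2 δ) n`
when `L` is large. -/
theorem asympRate_le_of_tau_lt {r : ℕ} {δ ρ x : ℝ} (hδ₀ : 0 < δ) (hδ : δ < 1 / 2)
    (h1 : tau δ < ρ) (h2 : ρ < 1 / 2) (hx : 1 ≤ x) :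
    asympRate r δ ≤ ρ * Real.logb 2 x +
      Real.logb 2 (∑ i ∈ Finset.range (tt r + 1), beta r i x) / ((r : ℝ) + 1) := by
  set s := ∑ i ∈ Finset.range (tt r + 1), beta r i x with hs
  have hx0 : 0 < x := by linarith
  have hs0 : 0 < s := sum_beta_pos r hx0
  have hρ0 : 0 < ρ := (tau_pos hδ).trans h1
  obtain ⟨L, hL2, hL⟩ : ∃ L : ℕ, 2 ≤ L ∧
      1 - 2 * δ < 2 * Real.cos (Real.pi / L) * Real.sqrt (ρ * (1 - ρ)) := by
    have hlim : Filter.Tendsto (fun L : ℕ => 2 * Real.cos (Real.pi / L) *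
        Real.sqrt (ρ * (1 - ρ))) Filter.atTop
        (nhds (2 * Real.cos 0 * Real.sqrt (ρ * (1 - ρ)))) :=
      ((Real.continuous_cos.tendsto 0).comp
        (tendsto_const_div_atTop_nhds_zero_nat Real.pi)).const_mul 2 |>.mul_const _
    rw [Real.cos_zero, mul_one] at hlim
    exact ((Filter.eventually_ge_atTop 2).and
      (hlim.eventually_const_lt (one_sub_two_mul_lt hδ₀ hδ h1 h2))).exists
  have hfloor : Filter.Tendsto (fun n : ℕ => (⌊ρ * n⌋₊ : ℝ) / n) Filter.atTop (nhds ρ) :=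
    (tendsto_nat_floor_mul_div_atTop hρ0.le).comp tendsto_natCast_atTop_atTop
  have hLn := tendsto_const_div_atTop_nhds_zero_nat (L : ℝ)
  have hev1 : ∀ᶠ n : ℕ in Filter.atTop, 0 < (⌊ρ * n⌋₊ : ℝ) / n :=
    hfloor.eventually_const_lt hρ0
  have hev2 : ∀ᶠ n : ℕ in Filter.atTop, (⌊ρ * n⌋₊ : ℝ) / n + L / n < 1 := by
    refine (hfloor.add hLn).eventually_lt_const ?_
    linarith
  have hev3 : ∀ᶠ n : ℕ in Filter.atTop, (1 - 2 * δ) + 1 / (n : ℝ) <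
      2 * Real.cos (Real.pi / L) *
        Real.sqrt ((⌊ρ * n⌋₊ : ℝ) / n * (1 - (⌊ρ * n⌋₊ : ℝ) / n - L / n)) := by
    have l1 : Filter.Tendsto (fun n : ℕ => (1 - 2 * δ) + 1 / (n : ℝ)) Filter.atTop
        (nhds (1 - 2 * δ)) := by
      simpa using (tendsto_const_div_atTop_nhds_zero_nat (1 : ℝ)).const_add (1 - 2 * δ)
    have l2 := (((hfloor.mul ((hfloor.const_sub 1).sub hLn)).sqrt).const_mul
      (2 * Real.cos (Real.pi / L)))
    rw [sub_zero] at l2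
    exact l1.eventually_lt l2 hL
  refine asympRate_le_of_tendsto
    (K := fun n : ℕ => 2 * (δ * n) * x ^ (ρ * n + L) * s ^ ((n : ℝ) / (r + 1))) ?_ ?_
  · filter_upwards [hev1, hev2, hev3, Filter.eventually_gt_atTop 0] with n e1 e2 e3 hn
    have hn0 : (0 : ℝ) < n := by exact_mod_cast hn
    refine maxCard_le (by positivity) fun C hC hd => ?_
    set a := ⌊ρ * n⌋₊
    have ha : 1 ≤ a := by
      rw [Nat.one_le_iff_ne_zero]
      intro h0
      simp [h0] at e1
    have haL : a + L < n := by
      rw [← add_div, div_lt_one hn0] at e2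
      exact_mod_cast e2
    refine (card_le_of_minDistGE hC (by positivity) hd hx ha hL2 haL ?_).trans ?_
    · have hsq : Real.sqrt (a * (n - a - L)) =
          n * Real.sqrt ((a : ℝ) / n * (1 - (a : ℝ) / n - L / n)) := by
        have : (a : ℝ) * (n - a - L) =
            n ^ 2 * ((a : ℝ) / n * (1 - (a : ℝ) / n - L / n)) := by field_simp
        rw [this, Real.sqrt_mul (by positivity), Real.sqrt_sq hn0.le]
      rw [hsq]
      have e4 := mul_le_mul_of_nonneg_left e3.le hn0.le
      have e5 : (n : ℝ) * (1 - 2 * δ + 1 / n) = n - 2 * (δ * n) + 1 := by field_simp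
      linarith
    · gcongr
      rw [← Real.rpow_natCast]
      refine Real.rpow_le_rpow_of_exponent_le hx ?_
      push_cast
      gcongr
      exact Nat.floor_le (by positivity)
  · have l1 : Filter.Tendsto (fun n : ℕ => Real.logb 2 (n : ℝ) / n) Filter.atTop (nhds 0) := by
      have h := (Real.isLittleO_log_id_atTop.tendsto_div_nhds_zero.comp
        tendsto_natCast_atTop_atTop).div_const (Real.log 2)
      rw [zero_div] at h
      refine h.congr fun n => ?_
      simp only [Function.comp, id, Real.logb]
      ring
    have l2 := tendsto_const_div_atTop_nhds_zero_nat (Real.logb 2 (2 * δ))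
    have l3 := ((hLn.const_add ρ).mul_const (Real.logb 2 x)).add_const
      (Real.logb 2 s / ((r : ℝ) + 1))
    have l4 := (l2.add l1).add l3
    rw [add_zero, zero_add, add_zero] at l4
    refine l4.congr' ?_
    filter_upwards [Filter.eventually_gt_atTop 0] with n hn
    have hn0 : (0 : ℝ) < n := by exact_mod_cast hn
    have hxp : 0 < x ^ (ρ * n + L) := Real.rpow_pos_of_pos hx0 _
    have hsp : 0 < s ^ ((n : ℝ) / (r + 1)) := Real.rpow_pos_of_pos hs0 _
    rw [Real.logb_mul (by positivity) hsp.ne', Real.logb_mul (by positivity) hxp.ne',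
      Real.logb_rpow_eq_mul_logb_of_pos hs0, Real.logb_rpow_eq_mul_logb_of_pos hx0, ← mul_assoc,
      Real.logb_mul (by positivity) hn0.ne']
    field_simp
    ring

theorem asympRate_le_rateBound {r : ℕ} {δ x : ℝ} (hδ₀ : 0 < δ) (hδ : δ < 1 / 2) (hx : 1 ≤ x) :
    asympRate r δ ≤ rateBound r δ x := by
  have hlim : Filter.Tendsto (fun ρ : ℝ => ρ * Real.logb 2 x +
      Real.logb 2 (∑ i ∈ Finset.range (tt r + 1), beta r i x) / ((r : ℝ) + 1))
      (nhdsWithin (tau δ) (Set.Ioi (tau δ))) (nhds (rateBound r δ x)) :=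
    Filter.Tendsto.mono_left ((continuous_id.mul continuous_const).add
      continuous_const |>.tendsto _) nhdsWithin_le_nhds
  refine ge_of_tendsto hlim ?_
  filter_upwards [Ioo_mem_nhdsGT (tau_lt_half hδ₀ hδ)] with ρ hρ
  exact asympRate_le_of_tau_lt hδ₀ hδ hρ.1 hρ.2 hx

lemma betaMean_one_le_of_zero (r : ℕ) : betaMean r 1 ≤ ((r : ℝ) + 1) * tau 0 := by
  refine (betaMean_one_le r).trans ?_
  have h : ((2 * tt r : ℕ) : ℝ) ≤ ((r + 1 : ℕ) : ℝ) := by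
    exact_mod_cast (by unfold tt; omega : 2 * tt r ≤ r + 1)
  push_cast at h
  simp only [tau, zero_mul, Real.sqrt_zero]
  linarith

end LRC

end

theorem mainTheorem4 (r : ℕ) (δ : ℝ) (hδ₀ : 0 ≤ δ) (hδ : δ < 1 / 2) :
    (LRC.betaMean r 1 ≤ ((r : ℝ) + 1) * LRC.tau δ →
      LRC.asympRate r δ ≤ LRC.rateBound r δ 1) ∧
    (¬ LRC.betaMean r 1 ≤ ((r : ℝ) + 1) * LRC.tau δ →
      (∃ μ : ℝ,
        LRC.IsUniquePosRoot (LRC.rootPoly r δ (fun i => ((r + 1).choose i : ℝ))) μ ∧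
        LRC.asympRate r δ ≤ LRC.rateBound r δ μ) ∧
      (∃ μ : ℝ,
        LRC.IsUniquePosRoot (LRC.rootPoly r δ (LRC.bcoef r)) μ ∧
        LRC.asympRate r δ ≤ LRC.rateBound r δ μ)) := by
  refine ⟨fun _ => LRC.asympRate_le_rateBound_one r δ, fun h => ?_⟩
  -- for `δ = 0` the mean never exceeds `(r + 1) / 2`
  have hδ₁ : 0 < δ := by
    refine lt_of_le_of_ne hδ₀ ?_
    rintro rfl
    exact h (LRC.betaMean_one_le_of_zero r)
  have hτ := LRC.tau_pos hδ
  constructor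
  · obtain ⟨μ, hμ, hroot⟩ := LRC.exists_isUniquePosRoot
      (fun i hi => by
        exact_mod_cast Nat.choose_pos (by unfold LRC.tt at hi; omega : i ≤ r + 1)) hτ
      (LRC.eval_rootPoly_choose_one_neg h)
    exact ⟨μ, hroot, LRC.asympRate_le_rateBound hδ₁ hδ hμ.le⟩
  · obtain ⟨μ, hμ, hroot⟩ := LRC.exists_isUniquePosRoot (fun i hi => LRC.bcoef_pos hi) hτ
      (LRC.eval_rootPoly_bcoef_one_neg h)
    exact ⟨μ, hroot, LRC.asympRate_le_rateBound hδ₁ hδ hμ.le⟩
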